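/- Let $n\ge 1$ and let $\mathbb F=\{0,1\}$ be the binary field. A circulant Hadamard matrix of order $4n$ is a $4n\times 4n$ matrix $H$ with entries in $\{1,-1\}$ such that each row is obtained from the previous one by a cyclic shift one place to the right (if the first row is $(a_1,\dots,a_{4n})$, the second is $(a_{4n},a_1,\dots,a_{4n-1})$, and so on) and $HH^T=4nI$. Let $g=g_1+g_2x+\dots+g_{4n}x^{4n-1}\in\mathbb F[x]/(x^{4n}-1)$ with $g_i=0$ if $a_i=1$ and $g_i=1$ if $a_i=-1$, and let $u=1+x+\dots+x^{4n-1}$. The circulant Hadamard code of length $4n$ given by $H$ is the set $C\subseteq\mathbb F^{4n}$ of coefficient vectors of the polynomials $g+x^ig$ and $u+g+x^ig$, $1\le i\le 4n$. For a binary code $C\subseteq\mathbb F^{4n}$, its rank is the dimension of its linear span, and its kernel is the linear space $K(C)=\{x\in\mathbb F^{4n}: x+C=C\}$. Proposition. Let $C$ be a circulant Hadamard code of length $4n$ that is nonlinear, i.e. not a linear subspace of $\mathbb F^{4n}$. Then the kernel of $C$ has dimension $k=1$, and the rank of $C$ is $r=4n-1$. -/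

import Mathlib

open scoped Pointwise

/-- The circulant matrix with first row `a`, its rows and columns indexed by the residues
modulo `N`: each row is the previous one shifted cyclically by one place to the right. -/
def rowCirculant {N : ℕ} (a : ZMod N → ℤ) : Matrix (ZMod N) (ZMod N) ℤ :=
  Matrix.of fun i j => a (j - i)

/-- The binary generator of a sequence of signs: `1` is replaced by `0` and `-1` by `1`. A vector
`g : ZMod N → ZMod 2` stands for the class of the polynomial `∑ i, g i * x ^ i`
in `𝔽₂[x] / (x ^ N - 1)`. -/
def binaryGenerator {N : ℕ} (a : ZMod N → ℤ) : ZMod N → ZMod 2 :=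
  fun i => if a i = 1 then 0 else 1

/-- The cyclic shift of `g` by `i` places, that is, the coefficient vector of `x ^ i * g`
in `𝔽₂[x] / (x ^ N - 1)`. -/
def cyclicShift {N : ℕ} (i : ZMod N) (g : ZMod N → ZMod 2) : ZMod N → ZMod 2 :=
  fun j => g (j - i)

/-- The code consisting of the vectors `g + x ^ i * g` and their complements `u + g + x ^ i * g`,
where `u` (the constant function `1`) is the all-ones vector. -/
def circulantCode {N : ℕ} (g : ZMod N → ZMod 2) : Set (ZMod N → ZMod 2) :=
  {c | ∃ i : ZMod N, c = g + cyclicShift i g ∨ c = 1 + g + cyclicShift i g}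

/-- `C` is a circulant Hadamard code of length `N`: the code obtained from the binary generator
of some circulant Hadamard matrix of order `N`. Over `ℤ`, `Matrix.IsHadamard H` says that the
entries of `H` are `1` or `-1` and that `H Hᵀ = Hᵀ H = N I`. -/
def IsCirculantHadamardCode {N : ℕ} [NeZero N] (C : Set (ZMod N → ZMod 2)) : Prop :=
  ∃ a : ZMod N → ℤ, (rowCirculant a).IsHadamard ∧ C = circulantCode (binaryGenerator a)

/-- A binary code is linear if it is a linear subspace. -/
def IsLinearCode {ι : Type*} (C : Set (ι → ZMod 2)) : Prop :=
  ∃ W : Submodule (ZMod 2) (ι → ZMod 2), (W : Set (ι → ZMod 2)) = C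

/-- The rank of a binary code: the dimension of its linear span. -/
noncomputable def codeRank {ι : Type*} (C : Set (ι → ZMod 2)) : ℕ :=
  Module.finrank (ZMod 2) (Submodule.span (ZMod 2) C)

/-- The kernel `K(C) = {x | x + C = C}` of a binary code, as a linear subspace. -/
def codeKernel {ι : Type*} (C : Set (ι → ZMod 2)) : Submodule (ZMod 2) (ι → ZMod 2) where
  carrier := {x | x +ᵥ C = C}
  zero_mem' := zero_vadd _ C
  add_mem' := by
    intro x y hx hy
    simp only [Set.mem_ofPred_eq] at hx hy ⊢
    rw [add_vadd, hy, hx]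
  smul_mem' := by
    intro c x hx
    have hc : ∀ d : ZMod 2, d = 0 ∨ d = 1 := by decide
    rcases hc c with rfl | rfl
    · simp
    · simpa using hx

/-- The dimension of the kernel of a binary code. -/
noncomputable def kernelDim {ι : Type*} (C : Set (ι → ZMod 2)) : ℕ :=
  Module.finrank (ZMod 2) (codeKernel C)

/-!
Write the first row of the circulant Hadamard matrix as `a = 1 - 2 b` with `b` a `0`-`1` sequence
reducing to `g` modulo `2`. Orthogonality of the rows says that `a` is a perfect array: its periodic
autocorrelation is `4 n` at `0` and `0` elsewhere. In particular `4 n = s ^ 2` with `s = ∑ a`.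

The arithmetic input is Turyn's theorem that `n` is odd (`Matrix.IsHadamard.odd_of_rowCirculant`).
Write `s = ± 2 ^ k * v` with `v` odd. Sums over fibres push `a` forward to perfect arrays `A` on the
cyclic groups of order `2 ^ (j + 1)`. A faithful character sends `A` to an element `B` of
`ℤ[X] / (X ^ 2 ^ j + 1)` with `B * conj B = 2 ^ (2 * k) * v ^ 2`. There `2` is totally ramified and
its prime is stable under conjugation, so `2 ^ k` divides `B`, which means that entries of `A` at
distance `2 ^ j` agree modulo `2 ^ k` (`IsPerfectArray.dvd_sub_add_half`). On the quotient of order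
`2 ^ (2 * k)` all entries are odd, being sums of an odd number of signs; as long as the valuation is
less than `k - 1`, each further halving of the group doubles the entries up to odd factors
(`IsPerfectArray.exists_halve`). On the quotient of order `2 ^ (k + 1)` the energy
is thus `2 ^ (2 * k - 2)` times a sum of `2 ^ (k + 1)` odd squares, and for `k ≥ 2` a
comparison modulo `8` gives a contradiction (`IsPerfectArray.lt_two_of_odd`).

For `n` odd, `g` has odd weight and `g(x) * g(x⁻¹) = 1` in `𝔽₂[x] / (x ^ (4 n) - 1)`
(`Matrix.IsHadamard.binaryGenerator_autocorrelation`). So multiplication by `g` is a linear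
bijection; it fixes the all-ones vector and carries the code generated by the unit vector `e₀` to
the given code (`circulantCode_eq_image`). Rank, kernel dimension and linearity can therefore
be read off from the words `e₀ + eᵢ` and their complements: they span the words of even weight, and
their kernel is spanned by the all-ones vector once `4 n > 4`. For `n = 1` they
are all the words of even weight, and the code is linear.
-/

/-! ### Splitting powers of a prime between conjugate factors, and sums over residues -/

/-- A form of total ramification: if `π` is a prime element and `σ` a ring endomorphism that
maps `π` to an associate and reflects divisibility by `π`, then a power `π ^ (2 * e)` dividing
`b * σ b` splits evenly between the two factors. -/
theorem pow_dvd_of_pow_two_mul_dvd_mul_map {R : Type*} [CommRing R] [IsDomain R] {π : R}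
    (hπ : Prime π) (σ : R →+* R) (hσ : ∀ b, π ∣ σ b → π ∣ b) (hσπ : Associated (σ π) π)
    (e : ℕ) (b : R) (h : π ^ (2 * e) ∣ b * σ b) : π ^ e ∣ b := by
  induction e generalizing b with
  | zero => simp
  | succ e ih =>
    have h1 : π ∣ b * σ b := (dvd_pow_self π (by omega)).trans h
    have h2 : π ∣ b := (hπ.dvd_or_dvd h1).elim id (hσ b)
    obtain ⟨c, rfl⟩ := h2
    obtain ⟨u, hu⟩ := hσπ.symm
    have h3 : π ^ (2 * e) ∣ (c * σ c) * u := by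
      refine (mul_dvd_mul_iff_left (pow_ne_zero 2 hπ.ne_zero)).1 ?_
      convert h using 1
      · ring
      · rw [map_mul, ← hu]; ring
    rw [pow_succ']
    exact mul_dvd_mul_left _ (ih c ((Units.dvd_mul_right).1 h3))

theorem ZMod.sum_eq_sum_range {M : Type*} [AddCommMonoid M] (n : ℕ) [NeZero n] (f : ZMod n → M) :
    ∑ i, f i = ∑ r ∈ Finset.range n, f r := by
  refine Finset.sum_nbij' (fun i => i.val) (fun r => (r : ZMod n)) ?_ ?_ ?_ ?_ ?_
  · intro i _; simpa using ZMod.val_lt i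
  · simp
  · intro i _; simp
  · intro r hr; exact ZMod.val_cast_of_lt (by simpa using hr)
  · intro i _; simp

/-! ### Arithmetic of the ring `ℤ[X] / (X ^ 2 ^ j + 1)` -/

open Polynomial in
/-- The ring of integers of the field of roots of unity of order `2 ^ (j + 1)`, presented as
`ℤ[X] / (X ^ 2 ^ j + 1)`. -/
abbrev TwoPowCyclotomicRing (j : ℕ) : Type := AdjoinRoot (X ^ 2 ^ j + 1 : ℤ[X])

namespace TwoPowCyclotomicRing

open Polynomial

variable (j : ℕ)

theorem monic : (X ^ 2 ^ j + 1 : ℤ[X]).Monic := by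
  simpa using monic_X_pow_add_C (1 : ℤ) (n := 2 ^ j) (by positivity)

theorem degree_eq : (X ^ 2 ^ j + 1 : ℤ[X]).degree = (2 ^ j : ℕ) := by
  simpa using degree_X_pow_add_C (n := 2 ^ j) (by positivity) (1 : ℤ)

instance : IsDomain (TwoPowCyclotomicRing j) := by
  apply AdjoinRoot.isDomain_of_prime
  have h := (cyclotomic.irreducible (n := 2 ^ (j + 1)) (by positivity)).prime
  rw [cyclotomic_prime_pow_eq_geom_sum Nat.prime_two] at h
  simpa [Finset.sum_range_succ, add_comm] using h

/-- The distinguished primitive root of unity of order `2 ^ (j + 1)`. -/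
noncomputable abbrev zeta : TwoPowCyclotomicRing j := AdjoinRoot.root _

theorem zeta_pow : zeta j ^ 2 ^ j = -1 := by
  have h := AdjoinRoot.eval₂_root (X ^ 2 ^ j + 1 : ℤ[X])
  simp only [eval₂_add, eval₂_X_pow, eval₂_one] at h
  exact eq_neg_of_add_eq_zero_left h

/-- The inverse of `zeta`. -/
noncomputable def zetaInv : TwoPowCyclotomicRing j := -zeta j ^ (2 ^ j - 1)

theorem zeta_mul_zetaInv : zeta j * zetaInv j = 1 := by
  have h : zeta j * zeta j ^ (2 ^ j - 1) = zeta j ^ 2 ^ j := by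
    rw [← pow_succ', Nat.sub_add_cancel Nat.one_le_two_pow]
  rw [zetaInv, mul_neg, h, zeta_pow, neg_neg]

theorem zetaInv_pow : zetaInv j ^ 2 ^ j = -1 := by
  have h : zeta j ^ 2 ^ j * zetaInv j ^ 2 ^ j = 1 := by
    rw [← mul_pow, zeta_mul_zetaInv, one_pow]
  rw [zeta_pow] at h
  linear_combination -h

/-- Complex conjugation, the endomorphism that inverts `zeta`. -/
noncomputable def conj : TwoPowCyclotomicRing j →+* TwoPowCyclotomicRing j :=
  AdjoinRoot.lift (Int.castRingHom _) (zetaInv j) (by simp [zetaInv_pow])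

@[simp] theorem conj_zeta : conj j (zeta j) = zetaInv j := by simp [conj]

/-- Reduction modulo the prime above `2`, which sends `zeta` to `1`. -/
noncomputable def residue : TwoPowCyclotomicRing j →+* ZMod 2 :=
  AdjoinRoot.lift (Int.castRingHom _) 1 (by simpa using CharTwo.add_self_eq_zero (1 : ZMod 2))

@[simp] theorem residue_zeta : residue j (zeta j) = 1 := by simp [residue]

@[simp] theorem residue_zetaInv : residue j (zetaInv j) = 1 := by
  have h := congrArg (residue j) (zeta_mul_zetaInv j)
  simpa using h

theorem residue_conj (b : TwoPowCyclotomicRing j) : residue j (conj j b) = residue j b := by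
  have h : (residue j).comp (conj j) = residue j := by
    apply AdjoinRoot.ringHom_ext
    · exact RingHom.ext_int _ _
    · simp
  exact RingHom.congr_fun h b

theorem zeta_sub_one_dvd_two : zeta j - 1 ∣ 2 := by
  have h := sub_one_dvd_pow_sub_one (zeta j) (2 ^ j)
  rw [zeta_pow] at h
  rw [← dvd_neg]
  convert h using 1; norm_num

theorem zeta_sub_one_dvd_iff (b : TwoPowCyclotomicRing j) :
    zeta j - 1 ∣ b ↔ residue j b = 0 := by
  constructor
  · rintro ⟨c, rfl⟩; simp
  · intro h
    obtain ⟨p, rfl⟩ := AdjoinRoot.mk_surjective b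
    obtain ⟨q, hq⟩ := X_sub_C_dvd_sub_C_eval (a := (1 : ℤ)) (p := p)
    have hp : p = (X - C 1) * q + C (p.eval 1) := by rw [← hq]; ring
    have hmk : AdjoinRoot.mk (X ^ 2 ^ j + 1 : ℤ[X]) p =
        (zeta j - 1) * AdjoinRoot.mk _ q + ((p.eval 1 : ℤ) : TwoPowCyclotomicRing j) := by
      conv_lhs => rw [hp]
      simp
    rw [hmk] at h ⊢
    have h2 : (2 : ℤ) ∣ p.eval 1 := by
      rw [← Nat.cast_ofNat, ← ZMod.intCast_zmod_eq_zero_iff_dvd]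
      simpa using h
    obtain ⟨k, hk⟩ := h2
    refine dvd_add (dvd_mul_right _ _) ?_
    rw [hk]; push_cast
    exact (zeta_sub_one_dvd_two j).mul_right _

theorem two_ne_zero : (2 : TwoPowCyclotomicRing j) ≠ 0 := by
  intro h
  have h1 : AdjoinRoot.mk (X ^ 2 ^ j + 1 : ℤ[X]) (C 2) = 0 := by
    simpa only [map_ofNat] using h
  rw [AdjoinRoot.mk_eq_zero] at h1
  refine (monic j).not_dvd_of_degree_lt (by simp) ?_ h1
  rw [degree_eq, degree_C (by norm_num)]
  exact_mod_cast Nat.two_pow_pos j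

theorem prime_zeta_sub_one : Prime (zeta j - 1) := by
  refine ⟨fun h => ?_, fun h => ?_, fun b c h => ?_⟩
  · have := zeta_sub_one_dvd_two j
    rw [h, zero_dvd_iff] at this
    exact two_ne_zero j this
  · have := (zeta_sub_one_dvd_iff j 1).1 h.dvd
    simp at this
  · simp only [zeta_sub_one_dvd_iff, map_mul, mul_eq_zero] at h ⊢
    exact h

theorem associated_conj_zeta_sub_one : Associated (conj j (zeta j - 1)) (zeta j - 1) := by
  refine ⟨⟨-zeta j, -zetaInv j, ?_, ?_⟩, ?_⟩
  · linear_combination zeta_mul_zetaInv j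
  · linear_combination zeta_mul_zetaInv j
  · simp only [map_sub, conj_zeta, map_one]
    linear_combination -zeta_mul_zetaInv j

/-- Expanding `(1 + (zeta - 1)) ^ 2 ^ j = -1` by the binomial theorem shows that `2` divides
`(zeta - 1) ^ 2 ^ j` with a quotient prime to `zeta - 1`. -/
theorem exists_zeta_sub_one_pow_eq :
    ∃ q, (zeta j - 1) ^ 2 ^ j = 2 * q ∧ ¬ zeta j - 1 ∣ q := by
  set π := zeta j - 1 with hπ
  obtain ⟨s, hs⟩ := exists_add_pow_prime_pow_eq Nat.prime_two π 1 j
  refine ⟨-(1 + π * s), ?_, ?_⟩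
  · have h1 : π + 1 = zeta j := by rw [hπ]; ring
    rw [h1, zeta_pow, one_pow] at hs
    push_cast at hs
    linear_combination -hs
  · rw [hπ, zeta_sub_one_dvd_iff]; simp

theorem two_dvd_zeta_sub_one_pow : 2 ∣ (zeta j - 1) ^ 2 ^ j := by
  obtain ⟨q, hq, -⟩ := exists_zeta_sub_one_pow_eq j
  exact ⟨q, hq⟩

theorem zeta_sub_one_pow_dvd_two : (zeta j - 1) ^ 2 ^ j ∣ 2 := by
  obtain ⟨q, hq, hq'⟩ := exists_zeta_sub_one_pow_eq j
  have hπ := prime_zeta_sub_one j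
  suffices ∀ i ≤ 2 ^ j, (zeta j - 1) ^ i ∣ 2 from this _ le_rfl
  intro i
  induction i with
  | zero => simp
  | succ i ih =>
    intro hi
    obtain ⟨t, ht⟩ := ih (by omega)
    have h1 : (zeta j - 1) ^ (2 ^ j - i) = t * q := by
      apply mul_left_cancel₀ (pow_ne_zero i hπ.ne_zero)
      rw [← pow_add, Nat.add_sub_cancel' (by omega), hq, ht, mul_assoc]
    have h2 : zeta j - 1 ∣ t * q := h1 ▸ dvd_pow_self _ (by omega)
    have h3 : zeta j - 1 ∣ t := (hπ.dvd_or_dvd h2).resolve_right hq'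
    rw [ht, pow_succ]
    exact mul_dvd_mul_left _ h3

theorem two_pow_dvd_of_dvd_mul_conj (a : ℕ) (b : TwoPowCyclotomicRing j)
    (h : 2 ^ (2 * a) ∣ b * conj j b) : 2 ^ a ∣ b := by
  have h1 : (zeta j - 1) ^ (2 * (2 ^ j * a)) ∣ b * conj j b := by
    refine dvd_trans ?_ h
    rw [mul_left_comm, pow_mul]
    exact pow_dvd_pow_of_dvd (zeta_sub_one_pow_dvd_two j) _
  have h2 := pow_dvd_of_pow_two_mul_dvd_mul_map (prime_zeta_sub_one j) (conj j)
    (fun b => by simp only [zeta_sub_one_dvd_iff, residue_conj, imp_self])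
    (associated_conj_zeta_sub_one j) _ b h1
  refine dvd_trans ?_ h2
  rw [pow_mul]
  exact pow_dvd_pow_of_dvd (two_dvd_zeta_sub_one_pow j) _

/-- The powers `zeta ^ r` with `r < 2 ^ j` are a basis over `ℤ`, so divisibility by an integer can
be checked on coordinates. -/
theorem dvd_coeff_of_dvd_sum (m : ℕ) (c : ℕ → ℤ)
    (h : (m : TwoPowCyclotomicRing j) ∣
      ∑ r ∈ Finset.range (2 ^ j), (c r : TwoPowCyclotomicRing j) * zeta j ^ r)
    (r : ℕ) (hr : r < 2 ^ j) : (m : ℤ) ∣ c r := by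
  obtain ⟨b, hb⟩ := h
  obtain ⟨q, rfl⟩ := AdjoinRoot.mk_surjective b
  set p : ℤ[X] := ∑ r ∈ Finset.range (2 ^ j), C (c r) * X ^ r with hp
  have h1 : AdjoinRoot.mk (X ^ 2 ^ j + 1 : ℤ[X]) p = AdjoinRoot.mk _ ((m : ℤ[X]) * q) := by
    rw [map_mul, map_natCast, ← hb, hp, map_sum]
    simp
  rw [AdjoinRoot.mk_eq_mk] at h1
  let φ := Int.castRingHom (ZMod m)
  have h2 : (X ^ 2 ^ j + 1 : ℤ[X]).map φ ∣ p.map φ := by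
    have := Polynomial.map_dvd φ h1
    simpa using this
  have hdeg : p.degree < (2 ^ j : ℕ) := by
    rw [hp]
    refine (degree_sum_le _ _).trans_lt ?_
    rw [Finset.sup_lt_iff (WithBot.bot_lt_coe _)]
    intro r hr
    refine (degree_C_mul_X_pow_le r (c r)).trans_lt ?_
    exact_mod_cast Finset.mem_range.1 hr
  have h3 : p.map φ = 0 := by
    rcases subsingleton_or_nontrivial (ZMod m) with _ | _
    · exact Subsingleton.elim _ _
    by_contra h0
    refine ((monic j).map φ).not_dvd_of_degree_lt h0 ?_ h2
    rw [(monic j).degree_map, degree_eq]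
    exact degree_map_le.trans_lt hdeg
  have h4 : p.coeff r = c r := by
    simp [hp, coeff_X_pow, hr]
  rw [← ZMod.intCast_zmod_eq_zero_iff_dvd, ← h4]
  have := congrArg (fun s => coeff s r) h3
  simpa [φ] using this

end TwoPowCyclotomicRing

/-! ### Perfect arrays on finite abelian groups -/

/-- An integer array on a finite abelian group is perfect of energy `c` if its autocorrelation
is `c` at `0` and vanishes elsewhere. -/
def IsPerfectArray {G : Type*} [AddCommGroup G] [Fintype G] [DecidableEq G] (A : G → ℤ) (c : ℤ) :
    Prop :=
  ∀ d, ∑ x, A x * A (x + d) = if d = 0 then c else 0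

/-- The array on the target of a map whose entries are the sums of `A` over the fibres. -/
def fiberSum {G H : Type*} [Fintype G] [DecidableEq H] (f : G → H) (A : G → ℤ) (y : H) : ℤ :=
  ∑ x with f x = y, A x

namespace IsPerfectArray

variable {G H : Type*} [AddCommGroup G] [Fintype G] [DecidableEq G]
  [AddCommGroup H] [Fintype H] [DecidableEq H] {A : G → ℤ} {c : ℤ}

theorem map (hA : IsPerfectArray A c) (f : G →+ H) : IsPerfectArray (fiberSum f A) c := by
  intro d
  calc ∑ y, fiberSum f A y * fiberSum f A (y + d)
      = ∑ y, ∑ x with f x = y, A x * fiberSum f A (f x + d) := by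
        refine Finset.sum_congr rfl fun y _ => ?_
        rw [fiberSum, Finset.sum_mul]
        refine Finset.sum_congr rfl fun x hx => ?_
        rw [(Finset.mem_filter.1 hx).2]
    _ = ∑ x, A x * fiberSum f A (f x + d) :=
        Finset.sum_fiberwise _ _ fun x => A x * fiberSum f A (f x + d)
    _ = ∑ x, ∑ e with f e = d, A x * A (x + e) := by
        refine Finset.sum_congr rfl fun x _ => ?_
        rw [fiberSum, Finset.mul_sum, Finset.sum_filter, Finset.sum_filter,
          ← Equiv.sum_comp (Equiv.addLeft x)]
        refine Finset.sum_congr rfl fun e _ => ?_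
        simp
    _ = ∑ e with f e = d, ∑ x, A x * A (x + e) := Finset.sum_comm
    _ = ∑ e with f e = d, if e = 0 then c else 0 :=
        Finset.sum_congr rfl fun e _ => hA e
    _ = if d = 0 then c else 0 := by
        simp [Finset.sum_ite_eq', eq_comm]

theorem sum_sq (hA : IsPerfectArray A c) : ∑ x, A x ^ 2 = c := by
  simpa [sq] using hA 0

theorem sq_sum (hA : IsPerfectArray A c) : (∑ x, A x) ^ 2 = c := by
  calc (∑ x, A x) ^ 2 = ∑ x, ∑ d, A x * A (x + d) := by
        rw [sq, Finset.sum_mul]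
        refine Finset.sum_congr rfl fun x _ => ?_
        rw [← Finset.mul_sum]
        congr 1
        exact (Equiv.sum_comp (Equiv.addLeft x) A).symm
    _ = ∑ d : G, if d = 0 then c else 0 := by
        rw [Finset.sum_comm]
        exact Finset.sum_congr rfl fun d _ => hA d
    _ = c := by simp

/-- Every character sum of a perfect array has absolute square equal to the energy; here complex
conjugation is any ring endomorphism that inverts the character. -/
theorem charSum_mul_map_charSum {R : Type*} [CommRing R] (hA : IsPerfectArray A c)
    (χ : AddChar G R) (σ : R →+* R) (hσ : ∀ x, σ (χ x) = χ (-x)) :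
    (∑ x, (A x : R) * χ x) * σ (∑ x, (A x : R) * χ x) = c := by
  calc (∑ x, (A x : R) * χ x) * σ (∑ x, (A x : R) * χ x)
      = ∑ y, ∑ x, (A x : R) * A y * χ (x - y) := by
        rw [map_sum, Finset.sum_mul_sum, Finset.sum_comm]
        refine Finset.sum_congr rfl fun y _ => Finset.sum_congr rfl fun x _ => ?_
        rw [map_mul, map_intCast, hσ, sub_eq_add_neg, AddChar.map_add_eq_mul]
        ring
    _ = ∑ y, ∑ d, (A (y + d) : R) * A y * χ d := by
        refine Finset.sum_congr rfl fun y _ => ?_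
        rw [← Equiv.sum_comp (Equiv.addLeft y)]
        simp
    _ = ∑ d, ((∑ y, A y * A (y + d) : ℤ) : R) * χ d := by
        rw [Finset.sum_comm]
        refine Finset.sum_congr rfl fun d _ => ?_
        push_cast
        rw [Finset.sum_mul]
        refine Finset.sum_congr rfl fun y _ => by ring
    _ = c := by
        simp only [hA _]
        rw [Finset.sum_eq_single 0]
        · simp
        · intro d _ hd; simp [hd]
        · simp

/-- Total ramification of `2` in the field of roots of unity of order `2 ^ (j + 1)` forces the
character sums of a perfect array of energy divisible by `2 ^ (2 * a)` to be divisible by `2 ^ a`.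
On entries: those at distance `2 ^ j` are congruent modulo `2 ^ a`. -/
theorem dvd_sub_add_half {j a : ℕ} {A : ZMod (2 ^ (j + 1)) → ℤ} {c : ℤ} (hA : IsPerfectArray A c)
    (hc : 2 ^ (2 * a) ∣ c) (i : ZMod (2 ^ (j + 1))) :
    2 ^ a ∣ A i - A (i + (2 ^ j : ℕ)) := by
  open TwoPowCyclotomicRing in
  have hpow : (2 : ℕ) ^ (j + 1) = 2 ^ j + 2 ^ j := by ring
  have hζ : zeta j ^ 2 ^ (j + 1) = 1 := by rw [pow_succ, pow_mul, zeta_pow]; norm_num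
  let χ := AddChar.zmodChar (2 ^ (j + 1)) hζ
  have hχ : ∀ x, conj j (χ x) = χ (-x) := by
    intro x
    have h1 : χ x * χ (-x) = 1 := by
      rw [← AddChar.map_add_eq_mul, add_neg_cancel, AddChar.map_zero_eq_one]
    have h2 : χ x * conj j (χ x) = 1 := by
      simp only [χ, AddChar.zmodChar_apply, map_pow, conj_zeta]
      rw [← mul_pow, zeta_mul_zetaInv, one_pow]
    calc conj j (χ x) = (χ x * χ (-x)) * conj j (χ x) := by rw [h1, one_mul]
      _ = χ (-x) * (χ x * conj j (χ x)) := by ring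
      _ = χ (-x) := by rw [h2, mul_one]
  have h1 := hA.charSum_mul_map_charSum χ (conj j) hχ
  have h2 : 2 ^ a ∣ ∑ x, (A x : TwoPowCyclotomicRing j) * χ x := by
    apply two_pow_dvd_of_dvd_mul_conj
    rw [h1]
    have := map_dvd (Int.castRingHom (TwoPowCyclotomicRing j)) hc
    simpa using this
  have h3 : ∑ x, (A x : TwoPowCyclotomicRing j) * χ x =
      ∑ r ∈ Finset.range (2 ^ j),
        ((A r - A (r + (2 ^ j : ℕ)) : ℤ) : TwoPowCyclotomicRing j) * zeta j ^ r := by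
    rw [ZMod.sum_eq_sum_range, Finset.range_eq_Ico, ← Finset.sum_Ico_consecutive _ (Nat.zero_le _)
      (Nat.pow_le_pow_right two_pos j.le_succ), ← Finset.range_eq_Ico,
      Finset.sum_Ico_eq_sum_range, Nat.sub_eq_of_eq_add hpow, ← Finset.sum_add_distrib]
    refine Finset.sum_congr rfl fun r _ => ?_
    simp only [χ]
    rw [AddChar.zmodChar_apply', AddChar.zmodChar_apply', add_comm (2 ^ j) r,
      pow_add (zeta j), zeta_pow]
    push_cast
    ring
  have h4 : ∀ r : ℕ, r < 2 ^ j → (2 : ℤ) ^ a ∣ A r - A (r + (2 ^ j : ℕ)) := by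
    intro r hr
    have := dvd_coeff_of_dvd_sum j (2 ^ a) (fun r => A r - A (r + (2 ^ j : ℕ)))
      (by rw [← h3]; exact_mod_cast h2) r hr
    exact_mod_cast this
  have hlt := ZMod.val_lt i
  rcases lt_or_ge i.val (2 ^ j) with h | h
  · simpa using h4 i.val h
  · obtain ⟨r, hr⟩ := Nat.exists_eq_add_of_le' h
    have hi : i = (r : ZMod (2 ^ (j + 1))) + (2 ^ j : ℕ) := by
      rw [← Nat.cast_add, ← hr, ZMod.natCast_zmod_val]
    have hi' : i + (2 ^ j : ℕ) = (r : ZMod (2 ^ (j + 1))) := by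
      rw [hi, add_assoc, ← Nat.cast_add, ← hpow, ZMod.natCast_self, add_zero]
    rw [hi', dvd_sub_comm, hi]
    exact h4 r (by omega)

end IsPerfectArray

/-! ### Turyn's theorem -/

theorem fiberSum_castHom_two_pow {j : ℕ} (A : ZMod (2 ^ (j + 1)) → ℤ) (i : ZMod (2 ^ (j + 1))) :
    fiberSum (ZMod.castHom (pow_dvd_pow 2 j.le_succ) (ZMod (2 ^ j))) A
      (ZMod.castHom (pow_dvd_pow 2 j.le_succ) (ZMod (2 ^ j)) i) = A i + A (i + (2 ^ j : ℕ)) := by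
  have hpow : (2 : ℕ) ^ (j + 1) = 2 ^ j + 2 ^ j := by ring
  have hpos := Nat.two_pow_pos j
  have hne : ((2 ^ j : ℕ) : ZMod (2 ^ (j + 1))) ≠ 0 := by
    rw [Ne, ZMod.natCast_eq_zero_iff]
    exact Nat.not_dvd_of_pos_of_lt hpos (by omega)
  have hfib : ({x | ZMod.castHom (pow_dvd_pow 2 j.le_succ) (ZMod (2 ^ j)) x =
      ZMod.castHom (pow_dvd_pow 2 j.le_succ) (ZMod (2 ^ j)) i} : Finset _) =
      {i, i + (2 ^ j : ℕ)} := by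
    ext x
    simp only [Finset.mem_filter, Finset.mem_univ, true_and, Finset.mem_insert,
      Finset.mem_singleton]
    rw [← sub_eq_zero, ← map_sub, ← sub_eq_zero (a := x) (b := i),
      ← sub_eq_iff_eq_add' (a := x) (b := i)]
    generalize x - i = y
    have hy := ZMod.val_lt y
    rw [← ZMod.natCast_zmod_val y, map_natCast, ZMod.natCast_eq_zero_iff]
    constructor
    · rintro ⟨t, ht⟩
      have : t < 2 := by
        by_contra! h
        have := Nat.mul_le_mul_left (2 ^ j) h
        omega
      rw [ht]
      interval_cases t <;> simp
    · rintro (h | h)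
      · rw [ZMod.natCast_eq_zero_iff] at h
        exact (pow_dvd_pow 2 j.le_succ).trans h
      · have := congrArg ZMod.val h
        rw [ZMod.val_natCast_of_lt hy, ZMod.val_natCast_of_lt (by omega)] at this
        rw [this]
  rw [fiberSum, hfib, Finset.sum_pair]
  simpa using hne

/-- One step down the tower of quotients: if all entries have exact `2`-adic valuation `e < a - 1`
then, the two entries in each fibre being congruent modulo `2 ^ a`, all fibre sums have exact
valuation `e + 1`. -/
theorem IsPerfectArray.exists_halve {j a e : ℕ} {A : ZMod (2 ^ (j + 1)) → ℤ} {c : ℤ}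
    (hA : IsPerfectArray A c) (hc : 2 ^ (2 * a) ∣ c) (he : e + 2 ≤ a)
    (hodd : ∀ i, ∃ o, Odd o ∧ A i = 2 ^ e * o) :
    ∃ B : ZMod (2 ^ j) → ℤ, IsPerfectArray B c ∧ ∀ i, ∃ o, Odd o ∧ B i = 2 ^ (e + 1) * o := by
  refine ⟨_, hA.map (ZMod.castHom (pow_dvd_pow 2 j.le_succ) (ZMod (2 ^ j))).toAddMonoidHom, ?_⟩
  intro y
  obtain ⟨i, rfl⟩ := ZMod.castHom_surjective (pow_dvd_pow 2 j.le_succ) y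
  obtain ⟨o, ho, hi⟩ := hodd i
  obtain ⟨t, ht⟩ := hA.dvd_sub_add_half hc i
  obtain ⟨d, rfl⟩ := Nat.exists_eq_add_of_le he
  refine ⟨o - 2 * (2 ^ d * t), ho.sub_even (even_two_mul _), ?_⟩
  refine (fiberSum_castHom_two_pow A i).trans ?_
  have h : A (i + (2 ^ j : ℕ)) = A i - 2 ^ (e + 2 + d) * t := by linarith
  rw [h, hi]
  ring

/-- The fibres of `ZMod (2 ^ k * w) → ZMod (2 ^ k)` have `w` elements, so for `w` odd the fibre
sums of an array of odd integers are odd. -/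
theorem odd_fiberSum_castHom {N k w : ℕ} [NeZero N] (hN : N = 2 ^ k * w) (hw : Odd w)
    (A : ZMod N → ℤ) (hA : ∀ i, Odd (A i)) (y : ZMod (2 ^ k)) :
    Odd (fiberSum (ZMod.castHom (Dvd.intro w hN.symm) (ZMod (2 ^ k))) A y) := by
  set f := ZMod.castHom (Dvd.intro w hN.symm) (ZMod (2 ^ k))
  have hf : Function.Surjective f := ZMod.castHom_surjective _
  have hcard : ∀ z, (Finset.univ.filter fun x => f x = z).card =
      (Finset.univ.filter fun x => f x = y).card := fun z =>
    AddMonoidHom.card_fiber_eq_of_mem_range f.toAddMonoidHom (hf z) (hf y)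
  have hsum : ∑ z, (Finset.univ.filter fun x => f x = z).card = N := by
    rw [← Finset.card_eq_sum_card_fiberwise (fun _ _ => Finset.mem_coe.2 (Finset.mem_univ _))]
    simp
  simp only [hcard, Finset.sum_const, Finset.card_univ, ZMod.card, smul_eq_mul] at hsum
  have hw' : (Finset.univ.filter fun x => f x = y).card = w :=
    Nat.eq_of_mul_eq_mul_left (Nat.two_pow_pos k) (hsum.trans hN)
  have hA' : ∀ i, (A i : ZMod 2) = 1 := fun i => ZMod.intCast_eq_one_iff_odd.2 (hA i)
  rw [← ZMod.intCast_eq_one_iff_odd, fiberSum, Int.cast_sum]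
  simp only [hA', Finset.sum_const, hw', nsmul_one]
  exact ZMod.natCast_eq_one_iff_odd.2 hw

/-- On the quotient of order `2 ^ (a + 1)` all entries are `2 ^ (a - 1)` times an odd number, so
the energy condition says that `2 ^ (a + 1)` odd squares sum to `4 * v ^ 2`. Odd squares
being `1` modulo `8`, this is impossible for `a ≥ 2`. -/
theorem IsPerfectArray.lt_two_of_odd {N a v : ℕ} [NeZero N] (hN : N = 2 ^ (2 * a) * v ^ 2)
    (hv : Odd v) {A : ZMod N → ℤ} (hA : IsPerfectArray A N) (hodd : ∀ i, Odd (A i)) : a < 2 := by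
  by_contra! ha
  have key : ∀ e, e + 1 ≤ a → ∃ B : ZMod (2 ^ (2 * a - e)) → ℤ,
      IsPerfectArray B N ∧ ∀ i, ∃ o, Odd o ∧ B i = 2 ^ e * o := by
    intro e
    induction e with
    | zero =>
      intro _
      refine ⟨_, hA.map
        (ZMod.castHom (Dvd.intro (v ^ 2) hN.symm) (ZMod (2 ^ (2 * a)))).toAddMonoidHom,
        fun y => ⟨_, odd_fiberSum_castHom hN hv.pow A hodd y, ?_⟩⟩
      rw [pow_zero, one_mul]
      rfl
    | succ e ih =>
      intro he
      obtain ⟨B, hB, hB'⟩ := ih (by omega)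
      obtain ⟨j, hj⟩ : ∃ j, 2 * a - e = j + 1 := ⟨2 * a - e - 1, by omega⟩
      have hj' : 2 * a - (e + 1) = j := by omega
      rw [hj']
      revert B
      rw [hj]
      intro B hB hB'
      exact hB.exists_halve ⟨(v : ℤ) ^ 2, by rw [hN]; push_cast; rfl⟩ he hB'
  obtain ⟨B, hB, hB'⟩ := key (a - 1) (by omega)
  choose o ho hBo using hB'
  obtain ⟨b, rfl⟩ := Nat.exists_eq_add_of_le' ha
  have h1 := hB.sum_sq
  simp only [hBo, mul_pow, ← Finset.mul_sum] at h1
  have h2 : ∑ i, o i ^ 2 = 4 * (v : ℤ) ^ 2 := by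
    have h3 : ((2 : ℤ) ^ (b + 2 - 1)) ^ 2 ≠ 0 := by positivity
    apply mul_left_cancel₀ h3
    rw [h1, hN]
    push_cast
    ring
  have hsq : ∀ x : ℤ, Odd x → x ^ 2 ≡ 1 [ZMOD 8] := fun x hx =>
    (Int.modEq_iff_dvd.2 (Int.eight_dvd_sq_sub_one_of_odd hx)).symm
  have h4 : ∑ i, o i ^ 2 ≡ ∑ i : ZMod (2 ^ (2 * (b + 2) - (b + 2 - 1))), 1 [ZMOD 8] :=
    Int.ModEq.sum fun i _ => hsq _ (ho i)
  have h5 : (v : ℤ) ^ 2 ≡ 1 [ZMOD 8] := hsq _ (by exact_mod_cast hv)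
  rw [h2, Finset.sum_const, Finset.card_univ, ZMod.card,
    show 2 * (b + 2) - (b + 2 - 1) = b + 3 by omega, pow_add] at h4
  simp only [nsmul_eq_mul, mul_one] at h4
  push_cast at h4
  rw [Int.ModEq] at h4 h5
  omega

/-! ### Circulant Hadamard matrices and their binary generators -/

theorem Matrix.IsHadamard.isPerfectArray {N : ℕ} [NeZero N] {a : ZMod N → ℤ}
    (h : (rowCirculant a).IsHadamard) : IsPerfectArray a N := by
  intro d
  have h1 := congrFun (congrFun h.mul_conjTranspose 0) (-d)
  simpa [Matrix.mul_apply, rowCirculant, Matrix.one_apply, eq_comm (a := (0 : ZMod N))] using h1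

theorem Matrix.IsHadamard.eq_one_or_neg_one {N : ℕ} [NeZero N] {a : ZMod N → ℤ}
    (h : (rowCirculant a).IsHadamard) (i : ZMod N) : a i = 1 ∨ a i = -1 := by
  have h1 := (Unitary.mem_iff.1 (h.apply_mem 0 i)).1
  simp only [rowCirculant, Matrix.of_apply, sub_zero, star_trivial] at h1
  exact Int.isUnit_iff.1 (IsUnit.of_mul_eq_one _ h1)

/-- **Turyn's theorem**: the order of a circulant Hadamard matrix is four times an odd number. -/
theorem Matrix.IsHadamard.odd_of_rowCirculant {n : ℕ} [NeZero n] {a : ZMod (4 * n) → ℤ}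
    (h : (rowCirculant a).IsHadamard) : Odd n := by
  have hp := h.isPerfectArray
  set s := ∑ x, a x
  have hs : s.natAbs ^ 2 = 4 * n := by
    zify
    rw [sq_abs]
    exact_mod_cast hp.sq_sum
  have hs0 : s.natAbs ≠ 0 := by
    intro h0
    rw [h0] at hs
    exact NeZero.ne n (by omega)
  obtain ⟨k, v, hv, hk⟩ := Nat.exists_eq_two_pow_mul_odd hs0
  have hN : 4 * n = 2 ^ (2 * k) * v ^ 2 := by rw [← hs, hk]; ring
  have hodd : ∀ i, Odd (a i) := fun i => by
    rcases h.eq_one_or_neg_one i with h | h <;> rw [h] <;> decide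
  have hlt := hp.lt_two_of_odd hN hv hodd
  have hv2 : Odd (v ^ 2) := hv.pow
  interval_cases k
  · obtain ⟨t, ht⟩ := hv2; omega
  · have : n = v ^ 2 := by omega
    rwa [this]

/-- The binary generator of a circulant Hadamard matrix `H` is the reduction modulo `2`
of the `0`-`1` sequence `(1 - a) / 2`; since `n` is odd, it has odd weight and its autocorrelation
modulo `2` is that of a unit vector. -/
theorem Matrix.IsHadamard.binaryGenerator_autocorrelation {n : ℕ} [NeZero n]
    {a : ZMod (4 * n) → ℤ} (h : (rowCirculant a).IsHadamard) :
    ∑ x, binaryGenerator a x = 1 ∧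
      ∀ d, ∑ x, binaryGenerator a x * binaryGenerator a (x + d) = if d = 0 then 1 else 0 := by
  have hp := h.isPerfectArray
  have hn := h.odd_of_rowCirculant
  let b : ZMod (4 * n) → ℤ := fun x => if a x = 1 then 0 else 1
  have hb : ∀ x, binaryGenerator a x = (b x : ZMod 2) := fun x => by
    by_cases hx : a x = 1 <;> simp [binaryGenerator, b, hx]
  have hab : ∀ x, a x = 1 - 2 * b x := fun x => by
    rcases h.eq_one_or_neg_one x with hx | hx <;> simp [b, hx]
  have hw : Odd (∑ x, b x) := by
    have h1 := hp.sq_sum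
    simp only [hab, Finset.sum_sub_distrib, ← Finset.mul_sum, Finset.sum_const, Finset.card_univ,
      ZMod.card, nsmul_eq_mul, mul_one] at h1
    push_cast at h1
    have h2 : (2 * (n : ℤ) - ∑ x, b x) ^ 2 = n := by linarith
    have h3 : Odd ((2 * (n : ℤ) - ∑ x, b x) ^ 2) := by rw [h2]; exact_mod_cast hn
    have h4 := Int.odd_pow' two_ne_zero |>.1 h3
    have h5 := (even_two_mul (n : ℤ)).sub_odd h4
    simpa using h5
  refine ⟨?_, fun d => ?_⟩
  · simp only [hb, ← Int.cast_sum]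
    exact ZMod.intCast_eq_one_iff_odd.2 hw
  · simp only [hb, ← Int.cast_mul, ← Int.cast_sum]
    have hshift : ∑ x, b (x + d) = ∑ x, b x := Equiv.sum_comp (Equiv.addRight d) b
    have h1 : ∑ x, a x * a (x + d) =
        4 * n - 4 * ∑ x, b x + 4 * ∑ x, b x * b (x + d) := by
      calc ∑ x, a x * a (x + d)
          = ∑ x, (1 - 2 * b x - 2 * b (x + d) + 4 * (b x * b (x + d))) :=
            Finset.sum_congr rfl fun x _ => by rw [hab x, hab (x + d)]; ring
        _ = _ := by
            rw [Finset.sum_add_distrib, Finset.sum_sub_distrib, Finset.sum_sub_distrib,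
              ← Finset.mul_sum, ← Finset.mul_sum, ← Finset.mul_sum, hshift, Finset.sum_const,
              Finset.card_univ, ZMod.card, nsmul_eq_mul, mul_one]
            push_cast
            ring
    rw [hp d] at h1
    obtain ⟨w, hw⟩ := hw
    obtain ⟨m, hm⟩ := hn
    split_ifs at h1 ⊢ with hd
    · refine ZMod.intCast_eq_one_iff_odd.2 ⟨w, ?_⟩
      push_cast at h1
      linarith
    · refine ZMod.intCast_eq_zero_iff_even.2 ⟨w - m, ?_⟩
      have hm' : (n : ℤ) = 2 * m + 1 := by exact_mod_cast hm
      linarith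

/-! ### Linear equivalences preserve rank and kernel of a code -/

section Transport

variable {ι κ : Type*} (T : (ι → ZMod 2) ≃ₗ[ZMod 2] (κ → ZMod 2)) (C : Set (ι → ZMod 2))

theorem codeRank_image : codeRank (T '' C) = codeRank C := by
  have h : Submodule.span (ZMod 2) (T '' C) =
      (Submodule.span (ZMod 2) C).map (T : (ι → ZMod 2) →ₗ[ZMod 2] (κ → ZMod 2)) := by
    rw [Submodule.map_span]; rfl
  rw [codeRank, codeRank, h]
  exact LinearEquiv.finrank_map_eq T _

theorem codeKernel_image : codeKernel (T '' C) =
    (codeKernel C).map (T : (ι → ZMod 2) →ₗ[ZMod 2] (κ → ZMod 2)) := by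
  have h : ∀ x, T x ∈ codeKernel (T '' C) ↔ x ∈ codeKernel C := by
    intro x
    change T x +ᵥ T '' C = T '' C ↔ x +ᵥ C = C
    have h1 : T x +ᵥ T '' C = T '' (x +ᵥ C) := by
      rw [← Set.image_vadd, ← Set.image_vadd, Set.image_image, Set.image_image]
      exact Set.image_congr fun y _ => by simp [vadd_eq_add]
    rw [h1, T.injective.image_injective.eq_iff]
  ext y
  constructor
  · intro hy
    exact ⟨T.symm y, (h _).1 (by simpa using hy), by simp⟩
  · rintro ⟨x, hx, rfl⟩
    exact (h x).2 hx

theorem kernelDim_image : kernelDim (T '' C) = kernelDim C := by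
  rw [kernelDim, kernelDim, codeKernel_image]
  exact LinearEquiv.finrank_map_eq T _

variable {C} in
theorem IsLinearCode.image (hC : IsLinearCode C) : IsLinearCode (T '' C) := by
  obtain ⟨W, rfl⟩ := hC
  exact ⟨W.map (T : (ι → ZMod 2) →ₗ[ZMod 2] (κ → ZMod 2)), rfl⟩

end Transport

/-! ### The code generated by a unit vector -/

section UnitVector

variable {N : ℕ}

@[simp] theorem cyclicShift_single (i : ZMod N) :
    cyclicShift i (Pi.single 0 1) = Pi.single i 1 := by
  ext j
  simp [cyclicShift, Pi.single_apply, sub_eq_zero]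

theorem mem_circulantCode_single_iff (c : ZMod N → ZMod 2) :
    c ∈ circulantCode (Pi.single 0 1) ↔
      ∃ i, c = Pi.single 0 1 + Pi.single i 1 ∨ c = 1 + Pi.single 0 1 + Pi.single i 1 := by
  simp [circulantCode]

theorem one_add_mem_circulantCode {g c : ZMod N → ZMod 2} (hc : c ∈ circulantCode g) :
    1 + c ∈ circulantCode g := by
  obtain ⟨i, rfl | rfl⟩ := hc
  · exact ⟨i, Or.inr (add_assoc _ _ _).symm⟩
  · exact ⟨i, Or.inl (by rw [add_assoc, ← add_assoc, CharTwo.add_self_eq_zero, zero_add])⟩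

theorem one_mem_codeKernel_circulantCode (g : ZMod N → ZMod 2) :
    1 ∈ codeKernel (circulantCode g) := by
  change (1 : ZMod N → ZMod 2) +ᵥ circulantCode g = circulantCode g
  ext c
  rw [Set.mem_vadd_set]
  constructor
  · rintro ⟨d, hd, rfl⟩
    exact one_add_mem_circulantCode hd
  · intro hc
    refine ⟨1 + c, one_add_mem_circulantCode hc, ?_⟩
    rw [vadd_eq_add, ← add_assoc, CharTwo.add_self_eq_zero, zero_add]

theorem add_mem_of_mem_codeKernel {ι : Type*} {C : Set (ι → ZMod 2)} {x c : ι → ZMod 2}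
    (hx : x ∈ codeKernel C) (hc : c ∈ C) : x + c ∈ C := by
  have hx' : x +ᵥ C = C := hx
  rw [← hx']
  exact Set.vadd_mem_vadd_set hc

variable [NeZero N]

/-- The functional whose kernel consists of the words of even weight. -/
def weightParity (ι : Type*) [Fintype ι] : (ι → ZMod 2) →ₗ[ZMod 2] ZMod 2 :=
  Fintype.linearCombination (ZMod 2) (fun _ : ι => (1 : ZMod 2))

@[simp] theorem weightParity_apply {ι : Type*} [Fintype ι] (f : ι → ZMod 2) :
    weightParity ι f = ∑ i, f i := by
  simp [weightParity, Fintype.linearCombination_apply]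

theorem span_circulantCode_single (hN : Even N) :
    Submodule.span (ZMod 2) (circulantCode (Pi.single (0 : ZMod N) 1)) =
      (weightParity (ZMod N)).ker := by
  apply le_antisymm
  · rw [Submodule.span_le]
    intro c hc
    have h2 : (1 : ZMod 2) + 1 = 0 := CharTwo.add_self_eq_zero 1
    have hN' : (N : ZMod 2) = 0 := ZMod.natCast_eq_zero_iff_even.2 hN
    rw [mem_circulantCode_single_iff] at hc
    rw [SetLike.mem_coe, LinearMap.mem_ker, weightParity_apply]
    obtain ⟨i, rfl | rfl⟩ := hc <;> simp [Finset.sum_add_distrib, hN', h2]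
  · intro f hf
    rw [LinearMap.mem_ker, weightParity_apply] at hf
    have h : f = ∑ i, f i • (Pi.single 0 1 + Pi.single i 1 : ZMod N → ZMod 2) := by
      simp only [smul_add, Finset.sum_add_distrib, ← Finset.sum_smul, hf, zero_smul, zero_add]
      exact pi_eq_sum_univ' f
    rw [h]
    refine Submodule.sum_mem _ fun i _ => Submodule.smul_mem _ _ (Submodule.subset_span ?_)
    exact (mem_circulantCode_single_iff _).2 ⟨i, Or.inl rfl⟩

theorem codeRank_circulantCode_single (hN : Even N) :
    codeRank (circulantCode (Pi.single (0 : ZMod N) 1)) = N - 1 := by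
  have h : weightParity (ZMod N) ≠ 0 := by
    intro h0
    have := LinearMap.congr_fun h0 (Pi.single 0 1)
    simp at this
  have h1 := Module.Dual.finrank_ker_add_one_of_ne_zero h
  rw [Module.finrank_fintype_fun_eq_card, ZMod.card] at h1
  rw [codeRank, span_circulantCode_single hN]
  omega

/-- For `N > 4` distance considerations show that the kernel is spanned by the all-ones vector: if
`e₀ + eᵢ` with `i ≠ 0` lay in the kernel, then `eᵢ + eⱼ` would be a codeword for
each `j ≠ 0, i`, whereas the words of the code have support or cosupport `{0, l}`. -/
theorem codeKernel_circulantCode_single (hN : 4 < N) :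
    codeKernel (circulantCode (Pi.single (0 : ZMod N) 1)) = Submodule.span (ZMod 2) {1} := by
  have h2 : (1 : ZMod 2) + 1 = 0 := CharTwo.add_self_eq_zero 1
  have exists_avoiding : ∀ s : Finset (ZMod N), s.card ≤ 4 → ∃ x, x ∉ s := by
    intro s hs
    by_contra! h
    have : (Finset.univ : Finset (ZMod N)).card ≤ s.card :=
      Finset.card_le_card fun x _ => h x
    rw [Finset.card_univ, ZMod.card] at this
    omega
  have key : ∀ i : ZMod N, (Pi.single 0 1 + Pi.single i 1 : ZMod N → ZMod 2) ∈
      codeKernel (circulantCode (Pi.single (0 : ZMod N) 1)) → i = 0 := by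
    intro i hi
    by_contra hi0
    obtain ⟨j, hj⟩ := exists_avoiding {0, i} (Finset.card_le_two.trans (by norm_num))
    obtain ⟨p, hp⟩ := exists_avoiding {0, i, j} (Finset.card_le_three.trans (by norm_num))
    obtain ⟨q, hq⟩ := exists_avoiding {0, i, j, p} Finset.card_le_four
    simp only [Finset.mem_insert, Finset.mem_singleton, not_or] at hj hp hq
    have hmem := add_mem_of_mem_codeKernel hi
      ((mem_circulantCode_single_iff _).2 ⟨j, Or.inl rfl⟩)
    obtain ⟨l, hl | hl⟩ := (mem_circulantCode_single_iff _).1 hmem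
    · have hl0 := congrFun hl 0
      have hli := congrFun hl i
      simp only [Pi.add_apply, Pi.single_apply] at hl0 hli
      grind
    · have hlp := congrFun hl p
      have hlq := congrFun hl q
      simp only [Pi.add_apply, Pi.single_apply, Pi.one_apply] at hlp hlq
      grind
  have hone := one_mem_codeKernel_circulantCode (Pi.single (0 : ZMod N) 1)
  have hzero : (0 : ZMod N → ZMod 2) ∈ circulantCode (Pi.single (0 : ZMod N) 1) :=
    (mem_circulantCode_single_iff _).2 ⟨0, Or.inl (CharTwo.add_self_eq_zero _).symm⟩
  apply le_antisymm
  · intro x hx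
    have hxC := add_mem_of_mem_codeKernel hx hzero
    rw [add_zero] at hxC
    obtain ⟨i, rfl | rfl⟩ := (mem_circulantCode_single_iff _).1 hxC
    · rw [key i hx, CharTwo.add_self_eq_zero]
      exact zero_mem _
    · have hx' := add_mem hone hx
      rw [add_assoc, ← add_assoc, CharTwo.add_self_eq_zero, zero_add] at hx'
      rw [key i hx', add_assoc, CharTwo.add_self_eq_zero, add_zero]
      exact Submodule.mem_span_singleton_self 1
  · rw [Submodule.span_singleton_le_iff_mem]
    exact hone

theorem kernelDim_circulantCode_single (hN : 4 < N) :
    kernelDim (circulantCode (Pi.single (0 : ZMod N) 1)) = 1 := by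
  rw [kernelDim, codeKernel_circulantCode_single hN]
  exact finrank_span_singleton one_ne_zero

theorem isLinearCode_circulantCode_single_four :
    IsLinearCode (circulantCode (Pi.single (0 : ZMod 4) 1)) := by
  refine ⟨(weightParity (ZMod 4)).ker, ?_⟩
  rw [← span_circulantCode_single (by decide)]
  refine Set.Subset.antisymm ?_ Submodule.subset_span
  rw [span_circulantCode_single (by decide)]
  intro f hf
  rw [SetLike.mem_coe, LinearMap.mem_ker, weightParity_apply] at hf
  rw [mem_circulantCode_single_iff]
  revert f
  decide +kernel

end UnitVector

/-! ### Reduction to the unit vector -/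

section Convolution

variable {N : ℕ} [NeZero N] {g : ZMod N → ZMod 2}

/-- Convolution with `g`, that is, multiplication by `g` in `𝔽₂[x] / (x ^ N - 1)`. -/
def convolution (g : ZMod N → ZMod 2) : (ZMod N → ZMod 2) →ₗ[ZMod 2] (ZMod N → ZMod 2) :=
  (Matrix.of fun i j => g (j - i)).vecMulLinear

theorem convolution_apply (f : ZMod N → ZMod 2) (j : ZMod N) :
    convolution g f j = ∑ i, f i * g (j - i) := rfl

theorem convolution_single (i : ZMod N) : convolution g (Pi.single i 1) = cyclicShift i g := by
  ext j
  simp [convolution_apply, Pi.single_apply, cyclicShift]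

theorem convolution_one (hg : ∑ x, g x = 1) : convolution g 1 = 1 := by
  ext j
  simp only [convolution_apply, Pi.one_apply, one_mul]
  rw [← hg]
  exact Equiv.sum_comp (Equiv.subLeft j) g

/-- The reversed sequence of `g` is an inverse of `g` when the autocorrelation of `g` is that of a
unit vector. -/
theorem convolution_injective
    (hg : ∀ d, ∑ x, g x * g (x + d) = if d = 0 then 1 else 0) :
    Function.Injective (convolution g) := by
  have h : (Matrix.of fun i j : ZMod N => g (j - i)) *
      (Matrix.of fun i j : ZMod N => g (j - i)).transpose = 1 := by
    ext i j
    simp only [Matrix.mul_apply, Matrix.transpose_apply, Matrix.of_apply, Matrix.one_apply]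
    rw [← Equiv.sum_comp (Equiv.addRight i)]
    simpa [add_sub_assoc, sub_eq_zero] using hg (i - j)
  exact Matrix.vecMul_injective_of_isUnit (IsUnit.of_mul_eq_one _ h)

theorem circulantCode_eq_image (hg : ∑ x, g x = 1) :
    circulantCode g = convolution g '' circulantCode (Pi.single 0 1) := by
  have h0 : convolution g (Pi.single 0 1) = g := by
    rw [convolution_single]; ext j; simp [cyclicShift]
  ext c
  simp only [Set.mem_image, mem_circulantCode_single_iff]
  constructor
  · rintro ⟨i, rfl | rfl⟩
    · exact ⟨_, ⟨i, Or.inl rfl⟩, by rw [map_add, h0, convolution_single]⟩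
    · exact ⟨_, ⟨i, Or.inr rfl⟩, by
        rw [map_add, map_add, h0, convolution_single, convolution_one hg]⟩
  · rintro ⟨_, ⟨i, rfl | rfl⟩, rfl⟩
    · exact ⟨i, Or.inl (by rw [map_add, h0, convolution_single])⟩
    · exact ⟨i, Or.inr (by
        rw [map_add, map_add, h0, convolution_single, convolution_one hg])⟩

end Convolution

theorem mainTheorem3 (n : ℕ) [NeZero n] (C : Set (ZMod (4 * n) → ZMod 2))
    (hC : IsCirculantHadamardCode C) (hnl : ¬ IsLinearCode C) :
    kernelDim C = 1 ∧ codeRank C = 4 * n - 1 := by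
  obtain ⟨a, ha, rfl⟩ := hC
  obtain ⟨hsum, hauto⟩ := ha.binaryGenerator_autocorrelation
  let T := LinearEquiv.ofInjectiveEndo _ (convolution_injective hauto)
  have hT : circulantCode (binaryGenerator a) = T '' circulantCode (Pi.single 0 1) :=
    circulantCode_eq_image hsum
  rw [hT] at hnl ⊢
  have hn : 4 < 4 * n := by
    have h0 := NeZero.ne n
    by_contra! h
    obtain rfl : n = 1 := by omega
    exact hnl (isLinearCode_circulantCode_single_four.image T)
  rw [kernelDim_image, codeRank_image]
  exact ⟨kernelDim_circulantCode_single hn,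
    codeRank_circulantCode_single ((show Even 4 by decide).mul_right n)⟩
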